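/- **Theorem (Noninterference for the Sealing Calculus).** Let $(\mathcal{L}, \sqsubseteq)$ be a partially ordered set of security levels. The *sealing calculus* over $\mathcal{L}$ is the simply typed $\lambda$-calculus with (possibly no) uninterpreted base types, a unit type, $\mathsf{Bool}$, products, coproducts and function types, extended with a type $[A]_\ell$ ("$A$ sealed at $\ell$") for each type $A$ and each $\ell \in \mathcal{L}$. Its typing judgements $\Gamma ; \pi \vdash M : A$ carry a finite set $\pi \subseteq \mathcal{L}$ of observer levels. Write $\ell \sqsubseteq \pi$ if $\ell \sqsubseteq k$ for some $k \in \pi$. The rules for sealed types are $$\frac{\Gamma ; \pi \cup \{\ell\} \vdash M : A}{\Gamma ; \pi \vdash [M]_\ell : [A]_\ell} \qquad\qquad \frac{\Gamma ; \pi \vdash M : [A]_\ell \quad \ell \sqsubseteq \pi}{\Gamma ; \pi \vdash M^\ell : A}$$ and all other rules are the usual ones for simple types, with $\pi$ held constant; in particular $\mathsf{tt}, \mathsf{ff} : \mathsf{Bool}$, and $\mathsf{if}\ M\ \mathsf{then}\ E_1\ \mathsf{else}\ E_0 : C$ whenever $M : \mathsf{Bool}$ and $E_0, E_1 : C$. The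 equality judgement $\Gamma ; \pi \vdash M = N : A$ is the least typed congruence containing the usual computation ($\beta$) rules for functions, products, coproducts and $\mathsf{Bool}$, together with $([M]_\ell)^\ell = M$ (where $\Gamma ; \pi \cup \{\ell\} \vdash M : A$ and $\ell \sqsubseteq \pi$). Let $A$ be a non-empty type, i.e. one for which there is a closed term of type $A$ at some finite set of observer levels. Let $\pi \subseteq \mathcal{L}$ be finite and let $\ell \in \mathcal{L}$ with $\ell \not\sqsubseteq \pi$. Then for all closed terms $\cdot\, ; \pi \vdash M : [A]_\ell$ and $\cdot\, ; \pi \vdash N : [A]_\ell$, and every term $x : [A]_\ell ; \pi \vdash E : \mathsf{Bool}$, we have $$\cdot\, ; \pi \vdash E[M/x] = E[N/x] : \mathsf{Bool}.$$ -/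

import Mathlib

/-!
The sealing calculus: the simply typed lambda-calculus (base types, unit, booleans, products,
coproducts, functions) over a partial order `L` of security levels, extended with sealed types.
Terms are raw terms with de Bruijn indices; typing and equality are judgements
`Γ ; π ⊢ M : A` and `Γ ; π ⊢ M = N : A`, where `π` is a finite set of observer levels.
-/

namespace SealingCalculus

universe u v

/-- Types. `B` is a set of names of uninterpreted base types, `L` the set of security levels. -/
inductive Ty (B : Type u) (L : Type v) : Type (max u v)
  | base (b : B)
  | unit
  | bool
  | prod (A C : Ty B L)
  | sum (A C : Ty B L)
  | arrow (A C : Ty B L)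
  /-- `sealed ℓ A` is the type `[A]_ℓ`. -/
  | sealed (ℓ : L) (A : Ty B L)

/-- Raw terms, with de Bruijn indices for variables and type annotations on binders and
injections. `sealAt ℓ M` is `[M]_ℓ`, and `unsealAt ℓ M` is `M^ℓ`. -/
inductive Tm (B : Type u) (L : Type v) : Type (max u v)
  | var (n : ℕ)
  | star
  | tt
  | ff
  /-- `ite M E₁ E₀` is `if M then E₁ else E₀`. -/
  | ite (M E₁ E₀ : Tm B L)
  | pair (M N : Tm B L)
  | fst (M : Tm B L)
  | snd (M : Tm B L)
  /-- `inl C M` is the left injection of `M` into a coproduct with right summand `C`. -/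
  | inl (C : Ty B L) (M : Tm B L)
  /-- `inr A M` is the right injection of `M` into a coproduct with left summand `A`. -/
  | inr (A : Ty B L) (M : Tm B L)
  /-- `caseOf M N₁ N₂` is case analysis on `M`; each of `N₁`, `N₂` binds one variable. -/
  | caseOf (M N₁ N₂ : Tm B L)
  /-- `lam A M` is `λ x : A. M`. -/
  | lam (A : Ty B L) (M : Tm B L)
  | app (M N : Tm B L)
  | sealAt (ℓ : L) (M : Tm B L)
  | unsealAt (ℓ : L) (M : Tm B L)

namespace Tm

variable {B : Type u} {L : Type v}

/-- Lifting of a renaming under one binder. -/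
def upRen (ρ : ℕ → ℕ) : ℕ → ℕ
  | 0 => 0
  | n + 1 => ρ n + 1

/-- Renaming of free variables. -/
def rename (ρ : ℕ → ℕ) : Tm B L → Tm B L
  | var n => var (ρ n)
  | star => star
  | tt => tt
  | ff => ff
  | ite M E₁ E₀ => ite (M.rename ρ) (E₁.rename ρ) (E₀.rename ρ)
  | pair M N => pair (M.rename ρ) (N.rename ρ)
  | fst M => fst (M.rename ρ)
  | snd M => snd (M.rename ρ)
  | inl C M => inl C (M.rename ρ)
  | inr A M => inr A (M.rename ρ)
  | caseOf M N₁ N₂ => caseOf (M.rename ρ) (N₁.rename (upRen ρ)) (N₂.rename (upRen ρ))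
  | lam A M => lam A (M.rename (upRen ρ))
  | app M N => app (M.rename ρ) (N.rename ρ)
  | sealAt ℓ M => sealAt ℓ (M.rename ρ)
  | unsealAt ℓ M => unsealAt ℓ (M.rename ρ)

/-- Lifting of a substitution under one binder. -/
def up (σ : ℕ → Tm B L) : ℕ → Tm B L
  | 0 => var 0
  | n + 1 => (σ n).rename Nat.succ

/-- Simultaneous capture-avoiding substitution. -/
def subst (σ : ℕ → Tm B L) : Tm B L → Tm B L
  | var n => σ n
  | star => star
  | tt => tt
  | ff => ff
  | ite M E₁ E₀ => ite (M.subst σ) (E₁.subst σ) (E₀.subst σ)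
  | pair M N => pair (M.subst σ) (N.subst σ)
  | fst M => fst (M.subst σ)
  | snd M => snd (M.subst σ)
  | inl C M => inl C (M.subst σ)
  | inr A M => inr A (M.subst σ)
  | caseOf M N₁ N₂ => caseOf (M.subst σ) (N₁.subst (up σ)) (N₂.subst (up σ))
  | lam A M => lam A (M.subst (up σ))
  | app M N => app (M.subst σ) (N.subst σ)
  | sealAt ℓ M => sealAt ℓ (M.subst σ)
  | unsealAt ℓ M => unsealAt ℓ (M.subst σ)

/-- The substitution that sends the variable `0` to `M` and lowers all other variables by one. -/
def single (M : Tm B L) : ℕ → Tm B L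
  | 0 => M
  | n + 1 => var n

/-- `E.inst M` is `E[M/x]`, where `x` is the most recently bound variable, of index `0`. -/
def inst (E M : Tm B L) : Tm B L :=
  E.subst (single M)

end Tm

/-- `ℓ ⊑ π`: the level `ℓ` is below some level of the finite set `π` of observer levels. -/
def Below {L : Type v} [PartialOrder L] (ℓ : L) (π : Finset L) : Prop :=
  ∃ k ∈ π, ℓ ≤ k

/-- The typing judgement `Γ ; π ⊢ M : A`. The head of the list `Γ` types the variable `0`. -/
inductive HasType {B : Type u} {L : Type v} [PartialOrder L] [DecidableEq L] :
    List (Ty B L) → Finset L → Tm B L → Ty B L → Prop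
  | var {Γ : List (Ty B L)} {π : Finset L} {n : ℕ} {A : Ty B L} :
      Γ[n]? = some A → HasType Γ π (.var n) A
  | star {Γ : List (Ty B L)} {π : Finset L} : HasType Γ π .star .unit
  | tt {Γ : List (Ty B L)} {π : Finset L} : HasType Γ π .tt .bool
  | ff {Γ : List (Ty B L)} {π : Finset L} : HasType Γ π .ff .bool
  | ite {Γ : List (Ty B L)} {π : Finset L} {M E₁ E₀ : Tm B L} {C : Ty B L} :
      HasType Γ π M .bool → HasType Γ π E₁ C → HasType Γ π E₀ C →
      HasType Γ π (.ite M E₁ E₀) C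
  | pair {Γ : List (Ty B L)} {π : Finset L} {M N : Tm B L} {A C : Ty B L} :
      HasType Γ π M A → HasType Γ π N C → HasType Γ π (.pair M N) (.prod A C)
  | fst {Γ : List (Ty B L)} {π : Finset L} {M : Tm B L} {A C : Ty B L} :
      HasType Γ π M (.prod A C) → HasType Γ π (.fst M) A
  | snd {Γ : List (Ty B L)} {π : Finset L} {M : Tm B L} {A C : Ty B L} :
      HasType Γ π M (.prod A C) → HasType Γ π (.snd M) C
  | inl {Γ : List (Ty B L)} {π : Finset L} {M : Tm B L} {A C : Ty B L} :
      HasType Γ π M A → HasType Γ π (.inl C M) (.sum A C)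
  | inr {Γ : List (Ty B L)} {π : Finset L} {M : Tm B L} {A C : Ty B L} :
      HasType Γ π M C → HasType Γ π (.inr A M) (.sum A C)
  | caseOf {Γ : List (Ty B L)} {π : Finset L} {M N₁ N₂ : Tm B L} {A C D : Ty B L} :
      HasType Γ π M (.sum A C) → HasType (A :: Γ) π N₁ D → HasType (C :: Γ) π N₂ D →
      HasType Γ π (.caseOf M N₁ N₂) D
  | lam {Γ : List (Ty B L)} {π : Finset L} {M : Tm B L} {A C : Ty B L} :
      HasType (A :: Γ) π M C → HasType Γ π (.lam A M) (.arrow A C)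
  | app {Γ : List (Ty B L)} {π : Finset L} {M N : Tm B L} {A C : Ty B L} :
      HasType Γ π M (.arrow A C) → HasType Γ π N A → HasType Γ π (.app M N) C
  | sealAt {Γ : List (Ty B L)} {π : Finset L} {ℓ : L} {M : Tm B L} {A : Ty B L} :
      HasType Γ (π ∪ {ℓ}) M A → HasType Γ π (.sealAt ℓ M) (.sealed ℓ A)
  | unsealAt {Γ : List (Ty B L)} {π : Finset L} {ℓ : L} {M : Tm B L} {A : Ty B L} :
      HasType Γ π M (.sealed ℓ A) → Below ℓ π → HasType Γ π (.unsealAt ℓ M) A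

/-- The equality judgement `Γ ; π ⊢ M = N : A`: the least typed congruence that contains the
computation rules of the calculus. No extensionality (`η`) laws are imposed, so this equality is
contained in the one that also has such laws. -/
inductive DefEq {B : Type u} {L : Type v} [PartialOrder L] [DecidableEq L] :
    List (Ty B L) → Finset L → Tm B L → Tm B L → Ty B L → Prop
  -- equivalence relation
  | refl {Γ : List (Ty B L)} {π : Finset L} {M : Tm B L} {A : Ty B L} :
      HasType Γ π M A → DefEq Γ π M M A
  | symm {Γ : List (Ty B L)} {π : Finset L} {M N : Tm B L} {A : Ty B L} :
      DefEq Γ π M N A → DefEq Γ π N M A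
  | trans {Γ : List (Ty B L)} {π : Finset L} {M N P : Tm B L} {A : Ty B L} :
      DefEq Γ π M N A → DefEq Γ π N P A → DefEq Γ π M P A
  -- congruence rules
  | ite {Γ : List (Ty B L)} {π : Finset L} {M M' E₁ E₁' E₀ E₀' : Tm B L} {C : Ty B L} :
      DefEq Γ π M M' .bool → DefEq Γ π E₁ E₁' C → DefEq Γ π E₀ E₀' C →
      DefEq Γ π (.ite M E₁ E₀) (.ite M' E₁' E₀') C
  | pair {Γ : List (Ty B L)} {π : Finset L} {M M' N N' : Tm B L} {A C : Ty B L} :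
      DefEq Γ π M M' A → DefEq Γ π N N' C → DefEq Γ π (.pair M N) (.pair M' N') (.prod A C)
  | fst {Γ : List (Ty B L)} {π : Finset L} {M M' : Tm B L} {A C : Ty B L} :
      DefEq Γ π M M' (.prod A C) → DefEq Γ π (.fst M) (.fst M') A
  | snd {Γ : List (Ty B L)} {π : Finset L} {M M' : Tm B L} {A C : Ty B L} :
      DefEq Γ π M M' (.prod A C) → DefEq Γ π (.snd M) (.snd M') C
  | inl {Γ : List (Ty B L)} {π : Finset L} {M M' : Tm B L} {A C : Ty B L} :
      DefEq Γ π M M' A → DefEq Γ π (.inl C M) (.inl C M') (.sum A C)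
  | inr {Γ : List (Ty B L)} {π : Finset L} {M M' : Tm B L} {A C : Ty B L} :
      DefEq Γ π M M' C → DefEq Γ π (.inr A M) (.inr A M') (.sum A C)
  | caseOf {Γ : List (Ty B L)} {π : Finset L} {M M' N₁ N₁' N₂ N₂' : Tm B L} {A C D : Ty B L} :
      DefEq Γ π M M' (.sum A C) → DefEq (A :: Γ) π N₁ N₁' D → DefEq (C :: Γ) π N₂ N₂' D →
      DefEq Γ π (.caseOf M N₁ N₂) (.caseOf M' N₁' N₂') D
  | lam {Γ : List (Ty B L)} {π : Finset L} {M M' : Tm B L} {A C : Ty B L} :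
      DefEq (A :: Γ) π M M' C → DefEq Γ π (.lam A M) (.lam A M') (.arrow A C)
  | app {Γ : List (Ty B L)} {π : Finset L} {M M' N N' : Tm B L} {A C : Ty B L} :
      DefEq Γ π M M' (.arrow A C) → DefEq Γ π N N' A → DefEq Γ π (.app M N) (.app M' N') C
  | sealAt {Γ : List (Ty B L)} {π : Finset L} {ℓ : L} {M M' : Tm B L} {A : Ty B L} :
      DefEq Γ (π ∪ {ℓ}) M M' A → DefEq Γ π (.sealAt ℓ M) (.sealAt ℓ M') (.sealed ℓ A)
  | unsealAt {Γ : List (Ty B L)} {π : Finset L} {ℓ : L} {M M' : Tm B L} {A : Ty B L} :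
      DefEq Γ π M M' (.sealed ℓ A) → Below ℓ π →
      DefEq Γ π (.unsealAt ℓ M) (.unsealAt ℓ M') A
  -- computation rules
  | ite_tt {Γ : List (Ty B L)} {π : Finset L} {E₁ E₀ : Tm B L} {C : Ty B L} :
      HasType Γ π E₁ C → HasType Γ π E₀ C → DefEq Γ π (.ite .tt E₁ E₀) E₁ C
  | ite_ff {Γ : List (Ty B L)} {π : Finset L} {E₁ E₀ : Tm B L} {C : Ty B L} :
      HasType Γ π E₁ C → HasType Γ π E₀ C → DefEq Γ π (.ite .ff E₁ E₀) E₀ C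
  | fst_pair {Γ : List (Ty B L)} {π : Finset L} {M N : Tm B L} {A C : Ty B L} :
      HasType Γ π M A → HasType Γ π N C → DefEq Γ π (.fst (.pair M N)) M A
  | snd_pair {Γ : List (Ty B L)} {π : Finset L} {M N : Tm B L} {A C : Ty B L} :
      HasType Γ π M A → HasType Γ π N C → DefEq Γ π (.snd (.pair M N)) N C
  | case_inl {Γ : List (Ty B L)} {π : Finset L} {M N₁ N₂ : Tm B L} {A C D : Ty B L} :
      HasType Γ π M A → HasType (A :: Γ) π N₁ D → HasType (C :: Γ) π N₂ D →
      DefEq Γ π (.caseOf (.inl C M) N₁ N₂) (N₁.inst M) D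
  | case_inr {Γ : List (Ty B L)} {π : Finset L} {M N₁ N₂ : Tm B L} {A C D : Ty B L} :
      HasType Γ π M C → HasType (A :: Γ) π N₁ D → HasType (C :: Γ) π N₂ D →
      DefEq Γ π (.caseOf (.inr A M) N₁ N₂) (N₂.inst M) D
  | app_lam {Γ : List (Ty B L)} {π : Finset L} {M N : Tm B L} {A C : Ty B L} :
      HasType (A :: Γ) π M C → HasType Γ π N A →
      DefEq Γ π (.app (.lam A M) N) (M.inst N) C
  | unseal_seal {Γ : List (Ty B L)} {π : Finset L} {ℓ : L} {M : Tm B L} {A : Ty B L} :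
      HasType Γ (π ∪ {ℓ}) M A → Below ℓ π →
      DefEq Γ π (.unsealAt ℓ (.sealAt ℓ M)) M A

/-- A type is non-empty if it has a closed term, at some set of observer levels. -/
def Ty.IsNonempty {B : Type u} {L : Type v} [PartialOrder L] [DecidableEq L]
    (A : Ty B L) : Prop :=
  ∃ (π : Finset L) (M : Tm B L), HasType [] π M A

end SealingCalculus

/-! The proof is by a binary logical relation `Rel π` on closed terms, for a fixed observer `π`. At
`bool`, related terms are provably equal to the same truth value; at products, sums and functions
the relation is the usual one. Base types and `unit` have no eliminators, so everything is related
there. At `[A]_ℓ`, related terms need only have related unsealings, and only if `ℓ ⊑ π`; at a level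
invisible to `π`, any two terms are related.

The relation is closed under provable equality (`Rel.of_defEq`), so the computation rules give the
fundamental lemma `HasType.rel`: a well-typed term sends related closing substitutions to related
terms. Applied to `E` and the substitutions by `M` and `N`, vacuously related at `[A]_ℓ`, it gives
related booleans, both equal to `tt` or both to `ff`. Neither normalization nor confluence is used.
-/

namespace SealingCalculus

/-! ### Algebra of renamings and substitutions -/

namespace Tm

variable {B : Type*} {L : Type*}

theorem upRen_comp (ρ ρ' : ℕ → ℕ) : upRen ρ ∘ upRen ρ' = upRen (ρ ∘ ρ') := by
  funext n
  cases n <;> rfl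

theorem rename_rename (M : Tm B L) (ρ ρ' : ℕ → ℕ) :
    (M.rename ρ').rename ρ = M.rename (ρ ∘ ρ') := by
  induction M generalizing ρ ρ' <;> simp_all [rename, upRen_comp]

theorem up_comp_upRen (σ : ℕ → Tm B L) (ρ : ℕ → ℕ) : up σ ∘ upRen ρ = up (σ ∘ ρ) := by
  funext n
  cases n <;> rfl

theorem subst_rename (M : Tm B L) (σ : ℕ → Tm B L) (ρ : ℕ → ℕ) :
    (M.rename ρ).subst σ = M.subst (σ ∘ ρ) := by
  induction M generalizing σ ρ <;> simp_all [rename, subst, up_comp_upRen]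

theorem rename_up (σ : ℕ → Tm B L) (ρ : ℕ → ℕ) :
    (fun n => (up σ n).rename (upRen ρ)) = up fun n => (σ n).rename ρ := by
  funext n
  cases n with
  | zero => rfl
  | succ n =>
    simp only [up, rename_rename]
    rfl

theorem rename_subst (M : Tm B L) (σ : ℕ → Tm B L) (ρ : ℕ → ℕ) :
    (M.subst σ).rename ρ = M.subst fun n => (σ n).rename ρ := by
  induction M generalizing σ ρ <;> simp_all [rename, subst, rename_up]

theorem subst_up (σ τ : ℕ → Tm B L) :
    (fun n => (up σ n).subst (up τ)) = up fun n => (σ n).subst τ := by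
  funext n
  cases n with
  | zero => rfl
  | succ n =>
    simp only [up, subst_rename, rename_subst]
    rfl

theorem subst_subst (M : Tm B L) (σ τ : ℕ → Tm B L) :
    (M.subst σ).subst τ = M.subst fun n => (σ n).subst τ := by
  induction M generalizing σ τ <;> simp_all [subst, subst_up]

theorem up_var : up (var : ℕ → Tm B L) = var := by
  funext n
  cases n <;> rfl

theorem subst_var (M : Tm B L) : M.subst var = M := by
  induction M <;> simp_all [subst, up_var]

/-- The substitution that sends the variable `0` to `P` and the variable `n + 1` to `σ n`. -/
def cons (P : Tm B L) (σ : ℕ → Tm B L) : ℕ → Tm B L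
  | 0 => P
  | n + 1 => σ n

/-- Turns the contractum of a `β`-step on a substituted binder into one simultaneous substitution,
the form in which the induction hypothesis of `HasType.rel` is available. -/
theorem inst_subst_up (M P : Tm B L) (σ : ℕ → Tm B L) :
    (M.subst (up σ)).inst P = M.subst (cons P σ) := by
  rw [inst, subst_subst]
  congr 1
  funext n
  cases n with
  | zero => rfl
  | succ n =>
    simp only [up, subst_rename]
    exact subst_var (σ n)

end Tm

variable {B : Type*} {L : Type*}

theorem upRen_getElem? {Γ Δ : List (Ty B L)} {ρ : ℕ → ℕ}
    (h : ∀ n A, Γ[n]? = some A → Δ[ρ n]? = some A) (C : Ty B L) (n : ℕ) (A : Ty B L)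
    (hn : (C :: Γ)[n]? = some A) : (C :: Δ)[Tm.upRen ρ n]? = some A := by
  cases n with
  | zero => simpa [Tm.upRen] using hn
  | succ n => simpa [Tm.upRen] using h n A (by simpa using hn)

/-! ### Observer levels and structural properties of typing -/

variable [PartialOrder L]

theorem Below.union_singleton [DecidableEq L] {π π' : Finset L}
    (h : ∀ k, Below k π → Below k π') (ℓ k : L) (hk : Below k (π ∪ {ℓ})) :
    Below k (π' ∪ {ℓ}) := by
  obtain ⟨j, hj, hkj⟩ := hk
  rcases Finset.mem_union.1 hj with hj | hj
  · obtain ⟨i, hi, hki⟩ := h k ⟨j, hj, hkj⟩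
    exact ⟨i, Finset.mem_union_left _ hi, hki⟩
  · exact ⟨j, Finset.mem_union_right _ hj, hkj⟩

/-- By transitivity, adjoining a level that is already visible makes no new level visible. -/
theorem Below.of_union_singleton [DecidableEq L] {π : Finset L} {ℓ k : L} (hℓ : Below ℓ π)
    (hk : Below k (π ∪ {ℓ})) : Below k π := by
  obtain ⟨j, hj, hkj⟩ := hk
  rcases Finset.mem_union.1 hj with hj | hj
  · exact ⟨j, hj, hkj⟩
  · obtain ⟨i, hi, hℓi⟩ := hℓ
    exact ⟨i, hi, hkj.trans ((Finset.mem_singleton.1 hj).le.trans hℓi)⟩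

theorem Below.mono {π π' : Finset L} (h : π ⊆ π') {k : L} (hk : Below k π) : Below k π' :=
  let ⟨j, hj, hkj⟩ := hk
  ⟨j, h hj, hkj⟩

variable [DecidableEq L]

/-- Typing uses `π` only through the levels below it. Comparing these down-sets, rather than asking
`π ⊆ π'`, lets one pass from `π ∪ {ℓ}` back to `π` when `ℓ ⊑ π`. -/
theorem HasType.mono {Γ : List (Ty B L)} {π π' : Finset L} {M : Tm B L} {A : Ty B L}
    (hM : HasType Γ π M A) (h : ∀ k, Below k π → Below k π') : HasType Γ π' M A := by
  induction hM generalizing π' with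
  | var hn => exact .var hn
  | star => exact .star
  | tt => exact .tt
  | ff => exact .ff
  | ite _ _ _ ih ih₁ ih₀ => exact .ite (ih h) (ih₁ h) (ih₀ h)
  | pair _ _ ih ih' => exact .pair (ih h) (ih' h)
  | fst _ ih => exact .fst (ih h)
  | snd _ ih => exact .snd (ih h)
  | inl _ ih => exact .inl (ih h)
  | inr _ ih => exact .inr (ih h)
  | caseOf _ _ _ ih ih₁ ih₂ => exact .caseOf (ih h) (ih₁ h) (ih₂ h)
  | lam _ ih => exact .lam (ih h)
  | app _ _ ih ih' => exact .app (ih h) (ih' h)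
  | sealAt _ ih => exact .sealAt (ih (Below.union_singleton h _))
  | unsealAt _ hb ih => exact .unsealAt (ih h) (h _ hb)

theorem HasType.rename {Γ Δ : List (Ty B L)} {π : Finset L} {M : Tm B L} {A : Ty B L}
    (hM : HasType Γ π M A) {ρ : ℕ → ℕ} (h : ∀ n A, Γ[n]? = some A → Δ[ρ n]? = some A) :
    HasType Δ π (M.rename ρ) A := by
  induction hM generalizing Δ ρ with
  | var hn => exact .var (h _ _ hn)
  | star => exact .star
  | tt => exact .tt
  | ff => exact .ff
  | ite _ _ _ ih ih₁ ih₀ => exact .ite (ih h) (ih₁ h) (ih₀ h)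
  | pair _ _ ih ih' => exact .pair (ih h) (ih' h)
  | fst _ ih => exact .fst (ih h)
  | snd _ ih => exact .snd (ih h)
  | inl _ ih => exact .inl (ih h)
  | inr _ ih => exact .inr (ih h)
  | caseOf _ _ _ ih ih₁ ih₂ =>
    exact .caseOf (ih h) (ih₁ (upRen_getElem? h _)) (ih₂ (upRen_getElem? h _))
  | lam _ ih => exact .lam (ih (upRen_getElem? h _))
  | app _ _ ih ih' => exact .app (ih h) (ih' h)
  | sealAt _ ih => exact .sealAt (ih h)
  | unsealAt _ hb ih => exact .unsealAt (ih h) hb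

/-- `σ` sends the variables of `Γ` to terms of the same type in the context `Δ`. -/
def SubstTyped (Γ Δ : List (Ty B L)) (π : Finset L) (σ : ℕ → Tm B L) : Prop :=
  ∀ n A, Γ[n]? = some A → HasType Δ π (σ n) A

theorem SubstTyped.up {Γ Δ : List (Ty B L)} {π : Finset L} {σ : ℕ → Tm B L}
    (h : SubstTyped Γ Δ π σ) (C : Ty B L) : SubstTyped (C :: Γ) (C :: Δ) π (Tm.up σ) := by
  intro n A hn
  cases n with
  | zero => exact .var (by simpa using hn)
  | succ n => exact (h n A (by simpa using hn)).rename fun n A hn => by simpa using hn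

theorem SubstTyped.mono {Γ Δ : List (Ty B L)} {π π' : Finset L} {σ : ℕ → Tm B L}
    (hσ : SubstTyped Γ Δ π σ) (h : π ⊆ π') : SubstTyped Γ Δ π' σ :=
  fun n A hn => (hσ n A hn).mono fun _ => Below.mono h

theorem HasType.subst {Γ Δ : List (Ty B L)} {π : Finset L} {M : Tm B L} {A : Ty B L}
    (hM : HasType Γ π M A) {σ : ℕ → Tm B L} (h : SubstTyped Γ Δ π σ) :
    HasType Δ π (M.subst σ) A := by
  induction hM generalizing Δ σ with
  | var hn => exact h _ _ hn
  | star => exact .star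
  | tt => exact .tt
  | ff => exact .ff
  | ite _ _ _ ih ih₁ ih₀ => exact .ite (ih h) (ih₁ h) (ih₀ h)
  | pair _ _ ih ih' => exact .pair (ih h) (ih' h)
  | fst _ ih => exact .fst (ih h)
  | snd _ ih => exact .snd (ih h)
  | inl _ ih => exact .inl (ih h)
  | inr _ ih => exact .inr (ih h)
  | caseOf _ _ _ ih ih₁ ih₂ => exact .caseOf (ih h) (ih₁ (h.up _)) (ih₂ (h.up _))
  | lam _ ih => exact .lam (ih (h.up _))
  | app _ _ ih ih' => exact .app (ih h) (ih' h)
  | sealAt _ ih => exact .sealAt (ih (h.mono Finset.subset_union_left))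
  | unsealAt _ hb ih => exact .unsealAt (ih h) hb

/-! ### The logical relation -/

/-- Indistinguishability of closed terms for an observer at `π`: a logical relation that is
trivial at types sealed at a level that is not below `π`. -/
def Rel (π : Finset L) : Ty B L → Tm B L → Tm B L → Prop
  | .base _, _, _ => True
  | .unit, _, _ => True
  | .bool, M, M' =>
    (DefEq [] π M .tt .bool ∧ DefEq [] π M' .tt .bool) ∨
      (DefEq [] π M .ff .bool ∧ DefEq [] π M' .ff .bool)
  | .prod A C, M, M' => Rel π A (.fst M) (.fst M') ∧ Rel π C (.snd M) (.snd M')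
  | .sum A C, M, M' =>
    (∃ P P', HasType [] π P A ∧ HasType [] π P' A ∧ DefEq [] π M (.inl C P) (.sum A C) ∧
      DefEq [] π M' (.inl C P') (.sum A C) ∧ Rel π A P P') ∨
    (∃ P P', HasType [] π P C ∧ HasType [] π P' C ∧ DefEq [] π M (.inr A P) (.sum A C) ∧
      DefEq [] π M' (.inr A P') (.sum A C) ∧ Rel π C P P')
  | .arrow A C, M, M' => ∀ P P', HasType [] π P A → HasType [] π P' A → Rel π A P P' →
      Rel π C (.app M P) (.app M' P')
  | .sealed ℓ A, M, M' => Below ℓ π → Rel π A (.unsealAt ℓ M) (.unsealAt ℓ M')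

/-- Each clause either is stated up to provable equality or applies an eliminator, and eliminators
are congruences. -/
theorem Rel.of_defEq {π : Finset L} {A : Ty B L} {M M' N N' : Tm B L} (h : Rel π A N N')
    (hM : DefEq [] π M N A) (hM' : DefEq [] π M' N' A) : Rel π A M M' := by
  induction A generalizing M M' N N' with
  | base | unit => trivial
  | bool =>
    exact h.imp (fun h => ⟨hM.trans h.1, hM'.trans h.2⟩) fun h => ⟨hM.trans h.1, hM'.trans h.2⟩
  | prod A C ihA ihC => exact ⟨ihA h.1 hM.fst hM'.fst, ihC h.2 hM.snd hM'.snd⟩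
  | sum A C =>
    rcases h with ⟨P, P', hP, hP', e, e', h⟩ | ⟨P, P', hP, hP', e, e', h⟩
    · exact .inl ⟨P, P', hP, hP', hM.trans e, hM'.trans e', h⟩
    · exact .inr ⟨P, P', hP, hP', hM.trans e, hM'.trans e', h⟩
  | arrow A C _ ihC =>
    intro P P' hP hP' hr
    exact ihC (h P P' hP hP' hr) (hM.app (.refl hP)) (hM'.app (.refl hP'))
  -- Only sealed types remain.
  | _ =>
    rename_i ih
    exact fun hb => ih (h hb) (hM.unsealAt hb) (hM'.unsealAt hb)

/-- Pointwise indistinguishability of two closing substitutions. -/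
def SubstRel (Γ : List (Ty B L)) (π : Finset L) (σ σ' : ℕ → Tm B L) : Prop :=
  ∀ n A, Γ[n]? = some A → Rel π A (σ n) (σ' n)

theorem SubstTyped.cons {Γ Δ : List (Ty B L)} {π : Finset L} {σ : ℕ → Tm B L}
    (h : SubstTyped Γ Δ π σ) {P : Tm B L} {C : Ty B L} (hP : HasType Δ π P C) :
    SubstTyped (C :: Γ) Δ π (Tm.cons P σ) := by
  intro n A hn
  cases n with
  | zero =>
    obtain rfl : C = A := by simpa using hn
    exact hP
  | succ n => exact h n A (by simpa using hn)

theorem SubstRel.cons {Γ : List (Ty B L)} {π : Finset L} {σ σ' : ℕ → Tm B L}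
    (h : SubstRel Γ π σ σ') {P P' : Tm B L} {C : Ty B L} (hP : Rel π C P P') :
    SubstRel (C :: Γ) π (Tm.cons P σ) (Tm.cons P' σ') := by
  intro n A hn
  cases n with
  | zero =>
    obtain rfl : C = A := by simpa using hn
    exact hP
  | succ n => exact h n A (by simpa using hn)

/-! ### The fundamental lemma -/

theorem DefEq.app_lam_subst {Γ Δ : List (Ty B L)} {π : Finset L} {M P : Tm B L} {A C : Ty B L}
    {σ : ℕ → Tm B L} (hM : HasType (A :: Γ) π M C) (hσ : SubstTyped Γ Δ π σ)
    (hP : HasType Δ π P A) :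
    DefEq Δ π (.app ((Tm.lam A M).subst σ) P) (M.subst (Tm.cons P σ)) C := by
  rw [← Tm.inst_subst_up]
  exact .app_lam (hM.subst (hσ.up A)) hP

theorem DefEq.case_inl_subst {Γ Δ : List (Ty B L)} {π : Finset L} {M N₁ N₂ P : Tm B L}
    {A C D : Ty B L} {σ : ℕ → Tm B L} (hM : DefEq Δ π (M.subst σ) (.inl C P) (.sum A C))
    (h₁ : HasType (A :: Γ) π N₁ D) (h₂ : HasType (C :: Γ) π N₂ D) (hσ : SubstTyped Γ Δ π σ)
    (hP : HasType Δ π P A) :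
    DefEq Δ π ((Tm.caseOf M N₁ N₂).subst σ) (N₁.subst (Tm.cons P σ)) D := by
  rw [← Tm.inst_subst_up]
  have h₁' := h₁.subst (hσ.up A)
  have h₂' := h₂.subst (hσ.up C)
  exact (hM.caseOf (.refl h₁') (.refl h₂')).trans (.case_inl hP h₁' h₂')

theorem DefEq.case_inr_subst {Γ Δ : List (Ty B L)} {π : Finset L} {M N₁ N₂ P : Tm B L}
    {A C D : Ty B L} {σ : ℕ → Tm B L} (hM : DefEq Δ π (M.subst σ) (.inr A P) (.sum A C))
    (h₁ : HasType (A :: Γ) π N₁ D) (h₂ : HasType (C :: Γ) π N₂ D) (hσ : SubstTyped Γ Δ π σ)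
    (hP : HasType Δ π P C) :
    DefEq Δ π ((Tm.caseOf M N₁ N₂).subst σ) (N₂.subst (Tm.cons P σ)) D := by
  rw [← Tm.inst_subst_up]
  have h₁' := h₁.subst (hσ.up A)
  have h₂' := h₂.subst (hσ.up C)
  exact (hM.caseOf (.refl h₁') (.refl h₂')).trans (.case_inr hP h₁' h₂')

/-- The fundamental lemma of the logical relation. The observer `π` is fixed, while the term may
be typed at any set `π'` that observes no more than `π`. -/
theorem HasType.rel {Γ : List (Ty B L)} {π π' : Finset L} {M : Tm B L} {A : Ty B L}
    (hM : HasType Γ π' M A) (hπ : ∀ k, Below k π' → Below k π) {σ σ' : ℕ → Tm B L}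
    (hσ : SubstTyped Γ [] π σ) (hσ' : SubstTyped Γ [] π σ') (hr : SubstRel Γ π σ σ') :
    Rel π A (M.subst σ) (M.subst σ') := by
  induction hM generalizing σ σ' with
  | var hn => exact hr _ _ hn
  | star => trivial
  | tt => exact .inl ⟨.refl .tt, .refl .tt⟩
  | ff => exact .inr ⟨.refl .ff, .refl .ff⟩
  | ite _ h₁ h₀ ih ih₁ ih₀ =>
    have h₁ := h₁.mono hπ
    have h₀ := h₀.mono hπ
    rcases ih hπ hσ hσ' hr with ⟨e, e'⟩ | ⟨e, e'⟩
    · exact (ih₁ hπ hσ hσ' hr).of_defEq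
        ((e.ite (.refl (h₁.subst hσ)) (.refl (h₀.subst hσ))).trans
          (.ite_tt (h₁.subst hσ) (h₀.subst hσ)))
        ((e'.ite (.refl (h₁.subst hσ')) (.refl (h₀.subst hσ'))).trans
          (.ite_tt (h₁.subst hσ') (h₀.subst hσ')))
    · exact (ih₀ hπ hσ hσ' hr).of_defEq
        ((e.ite (.refl (h₁.subst hσ)) (.refl (h₀.subst hσ))).trans
          (.ite_ff (h₁.subst hσ) (h₀.subst hσ)))
        ((e'.ite (.refl (h₁.subst hσ')) (.refl (h₀.subst hσ'))).trans
          (.ite_ff (h₁.subst hσ') (h₀.subst hσ')))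
  | pair h₁ h₂ ih₁ ih₂ =>
    have h₁ := h₁.mono hπ
    have h₂ := h₂.mono hπ
    exact ⟨(ih₁ hπ hσ hσ' hr).of_defEq (.fst_pair (h₁.subst hσ) (h₂.subst hσ))
        (.fst_pair (h₁.subst hσ') (h₂.subst hσ')),
      (ih₂ hπ hσ hσ' hr).of_defEq (.snd_pair (h₁.subst hσ) (h₂.subst hσ))
        (.snd_pair (h₁.subst hσ') (h₂.subst hσ'))⟩
  | fst _ ih => exact (ih hπ hσ hσ' hr).1
  | snd _ ih => exact (ih hπ hσ hσ' hr).2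
  | inl h ih =>
    have h := h.mono hπ
    exact .inl ⟨_, _, h.subst hσ, h.subst hσ', .refl (.inl (h.subst hσ)),
      .refl (.inl (h.subst hσ')), ih hπ hσ hσ' hr⟩
  | inr h ih =>
    have h := h.mono hπ
    exact .inr ⟨_, _, h.subst hσ, h.subst hσ', .refl (.inr (h.subst hσ)),
      .refl (.inr (h.subst hσ')), ih hπ hσ hσ' hr⟩
  | caseOf _ h₁ h₂ ih ih₁ ih₂ =>
    have h₁ := h₁.mono hπ
    have h₂ := h₂.mono hπ
    rcases ih hπ hσ hσ' hr with ⟨P, P', hP, hP', e, e', hPP'⟩ | ⟨P, P', hP, hP', e, e', hPP'⟩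
    · exact (ih₁ hπ (hσ.cons hP) (hσ'.cons hP') (hr.cons hPP')).of_defEq
        (.case_inl_subst e h₁ h₂ hσ hP) (.case_inl_subst e' h₁ h₂ hσ' hP')
    · exact (ih₂ hπ (hσ.cons hP) (hσ'.cons hP') (hr.cons hPP')).of_defEq
        (.case_inr_subst e h₁ h₂ hσ hP) (.case_inr_subst e' h₁ h₂ hσ' hP')
  | lam h ih =>
    have h := h.mono hπ
    intro P P' hP hP' hPP'
    exact (ih hπ (hσ.cons hP) (hσ'.cons hP') (hr.cons hPP')).of_defEq
      (.app_lam_subst h hσ hP) (.app_lam_subst h hσ' hP')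
  | app _ h ih ih' =>
    have h := h.mono hπ
    exact ih hπ hσ hσ' hr _ _ (h.subst hσ) (h.subst hσ') (ih' hπ hσ hσ' hr)
  | sealAt h ih =>
    intro hb
    have h := h.mono (Below.union_singleton hπ _)
    -- The body is typed at `π' ∪ {ℓ}`, but `ℓ ⊑ π` here, so this set still observes no more than
    -- `π` and the relation need not be taken at a larger observer.
    have hπ' k hk := hb.of_union_singleton (Below.union_singleton hπ _ k hk)
    exact (ih hπ' hσ hσ' hr).of_defEq
      (.unseal_seal (h.subst (hσ.mono Finset.subset_union_left)) hb)
      (.unseal_seal (h.subst (hσ'.mono Finset.subset_union_left)) hb)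
  | unsealAt _ hb ih => exact ih hπ hσ hσ' hr (hπ _ hb)

theorem SubstTyped.single {π : Finset L} {M : Tm B L} {A : Ty B L} (hM : HasType [] π M A) :
    SubstTyped [A] [] π (Tm.single M) := by
  intro n C hn
  cases n with
  | zero =>
    obtain rfl : A = C := by simpa using hn
    exact hM
  | succ n => simp at hn

theorem SubstRel.single {π : Finset L} {M N : Tm B L} {A : Ty B L} (h : Rel π A M N) :
    SubstRel [A] π (Tm.single M) (Tm.single N) := by
  intro n C hn
  cases n with
  | zero =>
    obtain rfl : A = C := by simpa using hn
    exact h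
  | succ n => simp at hn

end SealingCalculus

theorem mainTheorem8 {B : Type*} {L : Type*} [PartialOrder L] [DecidableEq L]
    (A : SealingCalculus.Ty B L) (hA : A.IsNonempty)
    (ℓ : L) (π : Finset L) (hℓ : ¬ SealingCalculus.Below ℓ π)
    (M N E : SealingCalculus.Tm B L)
    (hM : SealingCalculus.HasType [] π M (.sealed ℓ A))
    (hN : SealingCalculus.HasType [] π N (.sealed ℓ A))
    (hE : SealingCalculus.HasType [.sealed ℓ A] π E .bool) :
    SealingCalculus.DefEq [] π (E.inst M) (E.inst N) .bool := by
  -- The only place where `ℓ ⋢ π` enters: the condition guarding the sealed clause fails.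
  have hr : SealingCalculus.Rel π (.sealed ℓ A) M N := fun hb => absurd hb hℓ
  rcases hE.rel (fun _ => id) (.single hM) (.single hN) (.single hr) with ⟨e, e'⟩ | ⟨e, e'⟩
  · exact e.trans e'.symm
  · exact e.trans e'.symm
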